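/- Let $\pi<\beta<2\pi$ and $\gamma=\beta/\pi\in(1,2)$. Let $H=\{\zeta\in\mathbb C:\operatorname{Re}\zeta>0\}$ and $$z(\zeta)=(\zeta+1)^{\gamma}-\frac{1}{\gamma(2-\gamma)}(\bar\zeta+1)^{2-\gamma},\qquad \zeta\in H,$$ with principal branches of the powers. Then $z$ is harmonic and univalent (injective) on $H$, its image $D=z(H)$ is an unbounded plane domain, and there is a function $u$ on $\overline D$ with the following properties. 1. $u(z(\zeta))=2\operatorname{Re}\zeta$ for all $\zeta\in H$. 2. $u\in C^2(D)\cap C(\overline D)$, and $u$ satisfies the minimal surface equation $\operatorname{div}\dfrac{\nabla u}{\sqrt{1+|\nabla u|^2}}=0$ and $u>0$ in $D$, and $u=0$ on $\partial D$. 3. $D$ has asymptotic angle $\beta$, that is, $\limsup_{r\to\infty}\Theta^*(r)=\beta$, where $\Theta^*(r)$ is the angular measure of $D\cap\{|z|=r\}$ if $D$ does not contain the whole circle $\{|z|=r\}$, and $\Theta^*(r)=+\infty$ otherwise. 4. For every $r$ such that $D$ meets the circle $\{|z|=r\}$, the maximum $M(r)=\max\{u(z): z\in D,\ |z|=r\}$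 is attained, and $u$ has order of growth $\pi/\beta$, that is, $$\limsup_{r\to\infty}\frac{\log M(r)}{\log r}=\frac{\pi}{\beta}.$$ -/

import Mathlib

open Filter Topology MeasureTheory

noncomputable section

/-- The open right half-plane. -/
def rightHalfPlane : Set ℂ := {ζ | 0 < ζ.re}

/-- The harmonic map `ζ ↦ (ζ + 1)^γ - (ζ̄ + 1)^(2 - γ) / (γ (2 - γ))` (principal powers). -/
def harmonicMap (γ : ℝ) (ζ : ℂ) : ℂ :=
  (ζ + 1) ^ (γ : ℂ)
    - 1 / ((γ : ℂ) * (2 - (γ : ℂ))) * ((starRingEnd ℂ) ζ + 1) ^ (2 - (γ : ℂ))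

/-- Divergence of a vector field on the plane `ℂ = ℝ²`: `∂F₁/∂x + ∂F₂/∂y`. -/
def planeDivergence (F : ℂ → ℂ) (w : ℂ) : ℝ :=
  (fderiv ℝ F w 1).re + (fderiv ℝ F w Complex.I).im

/-- The minimal surface operator `div (∇u / √(1 + |∇u|²))`. -/
def minimalSurfaceOperator (u : ℂ → ℝ) (w : ℂ) : ℝ :=
  planeDivergence (fun v => (Real.sqrt (1 + ‖gradient u v‖ ^ 2))⁻¹ • gradient u v) w

/-- `D` is an unbounded plane domain. -/
structure IsUnboundedDomain (D : Set ℂ) : Prop where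
  isOpen : IsOpen D
  isConnected : IsConnected D
  unbounded : ¬ Bornology.IsBounded D

/-- `u` is a classical solution of the minimal surface equation in `D`, is positive in `D`,
and extends continuously by `0` to `∂D`. -/
structure IsPositiveMinimalGraph (D : Set ℂ) (u : ℂ → ℝ) : Prop where
  contDiffOn : ContDiffOn ℝ 2 u D
  continuousOn_closure : ContinuousOn u (closure D)
  minimal : ∀ w ∈ D, minimalSurfaceOperator u w = 0
  pos : ∀ w ∈ D, 0 < u w
  boundary : ∀ w ∈ frontier D, u w = 0

/-- `M(r)`, the maximum of `u` over the points of `D` with `|z| = r`. -/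
def circleMax (D : Set ℂ) (u : ℂ → ℝ) (r : ℝ) : ℝ :=
  sSup (u '' (D ∩ Metric.sphere 0 r))

/-- The order of growth `limsup_{r → ∞} log M(r) / log r`, as an extended real number. -/
def growthOrder (D : Set ℂ) (u : ℂ → ℝ) : EReal :=
  limsup (fun r : ℝ => ((Real.log (circleMax D u r) / Real.log r : ℝ) : EReal)) atTop

/-- `Θ(r)`, the angular measure of `D ∩ {|z| = r}`. -/
def angularMeasure (D : Set ℂ) (r : ℝ) : ENNReal :=
  volume {θ : ℝ | θ ∈ Set.Ioc (-Real.pi) Real.pi ∧ circleMap 0 r θ ∈ D}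

open Classical in
/-- `Θ*(r)`, which is `Θ(r)` if `D` does not contain the circle `|z| = r` and `+∞` otherwise. -/
def angularMeasureStar (D : Set ℂ) (r : ℝ) : ENNReal :=
  if Metric.sphere (0 : ℂ) r ⊆ D then ⊤ else angularMeasure D r

/-- The asymptotic angle `limsup_{r → ∞} Θ*(r)` of `D`. -/
def asymptoticAngle (D : Set ℂ) : ENNReal :=
  limsup (fun r : ℝ => angularMeasureStar D r) atTop

end

/-! With `P = γ (ζ + 1) ^ (γ - 1)` one has `dz = P dζ - P̄⁻¹ dζ̄`. Hence the map `(z, 2 Re ζ)` is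
harmonic and conformal: it is the Weierstrass representation of a minimal surface. The equation is
checked directly: `∇u = 2P / (|P|² - 1)`, so the flux is `2P / (1 + |P|²)`, and the chain rule
through the inverse of `z` shows that it is divergence free (`planeDivergence_weierstrass_flux`).

Global control comes from `Re P ≥ γ > 1` on the closed half-plane (`Complex.one_le_cpow_re`). It
makes `z` strongly monotone (`inner_sub_harmonicMap_sub`), which gives injectivity up to the
boundary, a Lipschitz inverse and properness. So `∂D` is the image of the imaginary axis, where `u =
0`.

Since `2 - γ < γ`, `z` behaves like `(ζ + 1) ^ γ` at infinity (`harmonicMap_asymptotic`). This power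
opens the half-plane to a sector of angle `γ π = β`, and `|ζ + 1|` has size `|z| ^ (1 / γ)`, whence
the order `π / β`. -/

noncomputable section

/-! ### Real-linear algebra and the divergence-free flux -/

/-- The real-linear map `v ↦ a v + b v̄` of the plane. -/
def wirtingerCLM (a b : ℂ) : ℂ →L[ℝ] ℂ :=
  ContinuousLinearMap.mul ℝ ℂ a +
    (ContinuousLinearMap.mul ℝ ℂ b).comp (Complex.conjCLE : ℂ →L[ℝ] ℂ)

@[simp] theorem wirtingerCLM_apply (a b v : ℂ) :
    wirtingerCLM a b v = a * v + b * (starRingEnd ℂ) v := by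
  simp [wirtingerCLM]

theorem wirtingerCLM_comp (a b c d : ℂ) :
    (wirtingerCLM a b).comp (wirtingerCLM c d) =
      wirtingerCLM (a * c + b * (starRingEnd ℂ) d) (a * d + b * (starRingEnd ℂ) c) := by
  ext v
  simp
  ring

/-- The invertible map `v ↦ a v - ā⁻¹ v̄`, for `1 < |a|`. -/
def weierstrassEquiv (a : ℂ) (ha : 1 < ‖a‖) : ℂ ≃L[ℝ] ℂ :=
  have h0 : a ≠ 0 := by rintro rfl; norm_num at ha
  have h0' : (starRingEnd ℂ) a ≠ 0 := by simpa using h0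
  have h1 : a * (starRingEnd ℂ) a - 1 ≠ 0 := by
    rw [Complex.mul_conj, Complex.normSq_eq_norm_sq]
    norm_cast
    nlinarith
  have h2 : a * (starRingEnd ℂ) a + 1 ≠ 0 := by
    rw [Complex.mul_conj, Complex.normSq_eq_norm_sq]
    norm_cast
    nlinarith
  have h3 : (starRingEnd ℂ) a * a - 1 ≠ 0 := by rwa [mul_comm]
  have h4 : (starRingEnd ℂ) a * a + 1 ≠ 0 := by rwa [mul_comm]
  have key : ∀ v, wirtingerCLM a (-((starRingEnd ℂ) a)⁻¹)
      (wirtingerCLM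
        ((starRingEnd ℂ) a * (a * (starRingEnd ℂ) a) /
          ((a * (starRingEnd ℂ) a - 1) * (a * (starRingEnd ℂ) a + 1)))
        (a / ((a * (starRingEnd ℂ) a - 1) * (a * (starRingEnd ℂ) a + 1))) v) = v := by
    intro v
    simp only [wirtingerCLM_apply, map_add, map_mul, map_div₀, map_sub, map_one,
      Complex.conj_conj]
    field_simp
    ring
  have key' : ∀ v, wirtingerCLM
        ((starRingEnd ℂ) a * (a * (starRingEnd ℂ) a) /
          ((a * (starRingEnd ℂ) a - 1) * (a * (starRingEnd ℂ) a + 1)))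
        (a / ((a * (starRingEnd ℂ) a - 1) * (a * (starRingEnd ℂ) a + 1)))
        (wirtingerCLM a (-((starRingEnd ℂ) a)⁻¹) v) = v := by
    intro v
    simp only [wirtingerCLM_apply, map_add, map_mul, map_neg, map_inv₀,
      Complex.conj_conj]
    field_simp
    ring
  ContinuousLinearEquiv.equivOfInverse (wirtingerCLM a (-((starRingEnd ℂ) a)⁻¹))
    (wirtingerCLM
      ((starRingEnd ℂ) a * (a * (starRingEnd ℂ) a) /
        ((a * (starRingEnd ℂ) a - 1) * (a * (starRingEnd ℂ) a + 1)))
      (a / ((a * (starRingEnd ℂ) a - 1) * (a * (starRingEnd ℂ) a + 1)))) key' key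

theorem coe_weierstrassEquiv_symm (a : ℂ) (ha : 1 < ‖a‖) :
    ((weierstrassEquiv a ha).symm : ℂ →L[ℝ] ℂ) = wirtingerCLM
      ((starRingEnd ℂ) a * (a * (starRingEnd ℂ) a) /
        ((a * (starRingEnd ℂ) a - 1) * (a * (starRingEnd ℂ) a + 1)))
      (a / ((a * (starRingEnd ℂ) a - 1) * (a * (starRingEnd ℂ) a + 1))) := rfl

/-- The conjugate-linear part contributes `b.re` to one partial derivative and `-b.re` to the other.
-/
theorem planeDivergence_of_hasFDerivAt {F : ℂ → ℂ} {w a b : ℂ}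
    (h : HasFDerivAt F (wirtingerCLM a b) w) : planeDivergence F w = 2 * a.re := by
  simp [planeDivergence, h.fderiv]
  ring

/-- The derivative of `p ↦ 2 p / (1 + |p|²)`. -/
theorem hasFDerivAt_two_mul_div_one_add_normSq (p : ℂ) :
    HasFDerivAt (fun p : ℂ => 2 * p / (1 + p * (starRingEnd ℂ) p))
      (wirtingerCLM (2 / (1 + p * (starRingEnd ℂ) p) ^ 2)
        (-(2 * p ^ 2) / (1 + p * (starRingEnd ℂ) p) ^ 2)) p := by
  have h2 : 1 + p * (starRingEnd ℂ) p ≠ 0 := by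
    rw [Complex.mul_conj, Complex.normSq_eq_norm_sq]
    norm_cast
    positivity
  have hid : HasFDerivAt (fun p : ℂ => p) (ContinuousLinearMap.id ℝ ℂ) p := hasFDerivAt_id p
  have hc : HasFDerivAt (fun p : ℂ => (starRingEnd ℂ) p) (Complex.conjCLE : ℂ →L[ℝ] ℂ) p :=
    Complex.conjCLE.hasFDerivAt
  have hn := (hid.const_mul (2 : ℂ)).mul
    ((hasFDerivAt_inv' (𝕜 := ℝ) h2).comp p ((hid.mul hc).const_add 1))
  refine hn.congr_fderiv ?_
  ext v
  simp
  field_simp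
  ring

/-- If the inverse `φ` of a map with Weierstrass data `P`, that is with differential
`v ↦ P v - P̄⁻¹ v̄`, pulls back the field `2 P / (1 + |P|²)`, then this field is divergence free. -/
theorem planeDivergence_weierstrass_flux {P φ : ℂ → ℂ} {w k : ℂ}
    (hP : HasDerivAt P k (φ w)) (h1 : 1 < ‖P (φ w)‖)
    (hφ : HasFDerivAt φ ((weierstrassEquiv (P (φ w)) h1).symm : ℂ →L[ℝ] ℂ) w) :
    planeDivergence (fun v => 2 * P (φ v) / (1 + P (φ v) * (starRingEnd ℂ) (P (φ v)))) w = 0 := by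
  have hP' : HasFDerivAt P (wirtingerCLM k 0) (φ w) := by
    refine hP.hasFDerivAt.restrictScalars ℝ |>.congr_fderiv ?_
    ext v
    simp [mul_comm]
  have h := (hasFDerivAt_two_mul_div_one_add_normSq (P (φ w))).comp w (hP'.comp w hφ)
  rw [coe_weierstrassEquiv_symm, wirtingerCLM_comp, wirtingerCLM_comp] at h
  refine (planeDivergence_of_hasFDerivAt h).trans ?_
  clear h hP' hφ hP
  generalize P (φ w) = p at h1 ⊢
  obtain ⟨t, ht⟩ : ∃ t : ℝ, p * (starRingEnd ℂ) p = t := ⟨_, Complex.mul_conj p⟩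
  have ht1 : 1 < t := by
    have : (t : ℂ) = ((‖p‖ ^ 2 : ℝ) : ℂ) := by
      rw [← ht, Complex.mul_conj, Complex.normSq_eq_norm_sq]
    have := Complex.ofReal_injective this
    nlinarith
  have ht1' : ((t : ℂ) - 1) ≠ 0 := by norm_cast; linarith
  have ht2' : ((t : ℂ) + 1) ≠ 0 := by norm_cast; linarith
  have ht3' : (1 + (t : ℂ)) ≠ 0 := by norm_cast; linarith
  -- The linear coefficient is a real multiple of `y - ȳ` with `y = k p̄`, hence purely imaginary,
  -- whatever the derivative `k` of `P` is.
  have e : ∀ x y : ℂ, x = ((2 * t / ((1 + t) ^ 2 * ((t - 1) * (t + 1))) : ℝ) : ℂ) *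
      (y - (starRingEnd ℂ) y) → 2 * x.re = 0 := by
    rintro x y rfl
    rw [Complex.re_ofReal_mul]
    simp
  refine e _ (k * (starRingEnd ℂ) p) ?_
  have hpc : (starRingEnd ℂ) p * p = t := by rw [mul_comm, ht]
  simp only [ht, map_add, map_mul, map_div₀, map_sub, map_one, Complex.conj_conj,
    Complex.conj_ofReal, zero_mul, add_zero]
  push_cast
  field_simp
  linear_combination (-p * (starRingEnd ℂ) k) * hpc

/-! ### Lower bound for the Weierstrass datum -/

/-- With `θ = arg s`, weighted AM-GM and concavity of the cosine give `cos θ ^ a ≤ a cos θ + (1 - a)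
≤ cos (a θ)`, so `Re (s ^ a) ≥ (Re s) ^ a`. -/
theorem Complex.one_le_cpow_re {s : ℂ} (hs : 1 ≤ s.re) {a : ℝ} (ha₀ : 0 ≤ a) (ha₁ : a ≤ 1) :
    1 ≤ (s ^ (a : ℂ)).re := by
  have hs0 : s ≠ 0 := by rintro rfl; norm_num at hs
  have hn : 0 < ‖s‖ := norm_pos_iff.2 hs0
  have hcos : 1 ≤ ‖s‖ * Real.cos s.arg := by
    rw [Complex.norm_mul_cos_arg]; exact hs
  have hcos0 : 0 < Real.cos s.arg := by
    by_contra! h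
    nlinarith
  have harg := abs_le.1 (Complex.abs_arg_le_pi_div_two_iff.2 (zero_le_one.trans hs))
  have hpi := Real.pi_pos
  have hconc := strictConcaveOn_cos_Icc.concaveOn.2 (x := s.arg) (y := 0)
    ⟨harg.1, harg.2⟩ ⟨by linarith, by linarith⟩ ha₀ (sub_nonneg.2 ha₁) (by ring)
  have hgm := Real.geom_mean_le_arith_mean2_weighted ha₀ (sub_nonneg.2 ha₁) hcos0.le zero_le_one
    (by ring)
  simp only [smul_eq_mul, mul_zero, add_zero, Real.cos_zero, Real.one_rpow] at hconc hgm
  rw [Complex.cpow_ofReal_re, mul_comm s.arg]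
  calc (1 : ℝ) ≤ (‖s‖ * Real.cos s.arg) ^ a := Real.one_le_rpow hcos ha₀
    _ = ‖s‖ ^ a * Real.cos s.arg ^ a := Real.mul_rpow hn.le hcos0.le
    _ ≤ ‖s‖ ^ a * Real.cos (a * s.arg) := by gcongr; linarith

/-- The Weierstrass datum `γ (ζ + 1)^(γ - 1)`, the `ζ`-derivative of `harmonicMap γ`. -/
def weierstrassDatum (γ : ℝ) (ζ : ℂ) : ℂ := γ * (ζ + 1) ^ ((γ - 1 : ℝ) : ℂ)

theorem le_weierstrassDatum_re {γ : ℝ} (h₁ : 1 < γ) (h₂ : γ < 2) {ζ : ℂ} (hζ : 0 ≤ ζ.re) :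
    γ ≤ (weierstrassDatum γ ζ).re := by
  have := Complex.one_le_cpow_re (s := ζ + 1) (by simpa using hζ) (a := γ - 1)
    (by linarith) (by linarith)
  rw [weierstrassDatum, Complex.re_ofReal_mul]
  nlinarith

theorem le_norm_weierstrassDatum {γ : ℝ} (h₁ : 1 < γ) (h₂ : γ < 2) {ζ : ℂ} (hζ : 0 ≤ ζ.re) :
    γ ≤ ‖weierstrassDatum γ ζ‖ :=
  (le_weierstrassDatum_re h₁ h₂ hζ).trans (Complex.re_le_norm _)

theorem add_one_mem_slitPlane {ζ : ℂ} (hζ : -1 < ζ.re) : ζ + 1 ∈ Complex.slitPlane := by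
  left
  simp
  linarith

theorem hasDerivAt_weierstrassDatum (γ : ℝ) {ζ : ℂ} (hζ : -1 < ζ.re) :
    HasDerivAt (weierstrassDatum γ)
      (γ * (((γ - 1 : ℝ) : ℂ) * (ζ + 1) ^ (((γ - 1 : ℝ) : ℂ) - 1) * 1)) ζ :=
  (((hasDerivAt_id ζ).add_const 1).cpow_const (add_one_mem_slitPlane hζ)).const_mul _

/-! ### Harmonicity and differential of `z` -/

theorem isOpen_neg_one_lt_re : IsOpen {ζ : ℂ | -1 < ζ.re} :=
  isOpen_lt continuous_const Complex.continuous_re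

/-- `harmonicMap` is the sum of a holomorphic and an antiholomorphic function. -/
theorem harmonicMap_eq (γ : ℝ) {ζ : ℂ} (hζ : -1 < ζ.re) :
    harmonicMap γ ζ = (ζ + 1) ^ (γ : ℂ) +
      (starRingEnd ℂ) (-(1 / ((γ : ℂ) * (2 - (γ : ℂ)))) * (ζ + 1) ^ (2 - (γ : ℂ))) := by
  have h : (starRingEnd ℂ) ζ + 1 = (starRingEnd ℂ) (ζ + 1) := by simp
  have harg : (ζ + 1).arg ≠ Real.pi := (Complex.mem_slitPlane_iff_arg.1 (add_one_mem_slitPlane hζ)).1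
  rw [harmonicMap, h, Complex.conj_cpow _ _ harg]
  have h2 : (starRingEnd ℂ) 2 = 2 := Complex.conj_ofNat 2
  simp [Complex.conj_ofReal, h2]
  ring

theorem harmonicMap_eventuallyEq (γ : ℝ) {ζ : ℂ} (hζ : -1 < ζ.re) :
    harmonicMap γ =ᶠ[𝓝 ζ] fun ζ => (ζ + 1) ^ (γ : ℂ) +
      (starRingEnd ℂ) (-(1 / ((γ : ℂ) * (2 - (γ : ℂ)))) * (ζ + 1) ^ (2 - (γ : ℂ))) := by
  filter_upwards [isOpen_neg_one_lt_re.mem_nhds hζ] with x hx using harmonicMap_eq γ hx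

theorem analyticAt_add_one_cpow (c : ℂ) {ζ : ℂ} (hζ : -1 < ζ.re) :
    AnalyticAt ℂ (fun ζ => (ζ + 1) ^ c) ζ :=
  (analyticAt_id.add analyticAt_const).cpow analyticAt_const (add_one_mem_slitPlane hζ)

theorem harmonicAt_harmonicMap (γ : ℝ) {ζ : ℂ} (hζ : -1 < ζ.re) :
    InnerProductSpace.HarmonicAt (harmonicMap γ) ζ := by
  rw [InnerProductSpace.harmonicAt_congr_nhds (harmonicMap_eventuallyEq γ hζ)]
  exact (analyticAt_add_one_cpow _ hζ).harmonicAt.add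
    ((analyticAt_const.mul (analyticAt_add_one_cpow _ hζ)).harmonicAt.comp_CLM
      (Complex.conjCLE : ℂ →L[ℝ] ℂ))

theorem contDiffAt_harmonicMap (γ : ℝ) {ζ : ℂ} (hζ : -1 < ζ.re) :
    ContDiffAt ℝ 2 (harmonicMap γ) ζ :=
  (harmonicAt_harmonicMap γ hζ).1

theorem hasFDerivAt_harmonicMap {γ : ℝ} (h₁ : 1 < γ) (h₂ : γ < 2) {ζ : ℂ} (hζ : -1 < ζ.re) :
    HasFDerivAt (harmonicMap γ)
      (wirtingerCLM (weierstrassDatum γ ζ) (-((starRingEnd ℂ) (weierstrassDatum γ ζ))⁻¹)) ζ := by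
  have hs := add_one_mem_slitPlane hζ
  have hs0 : ζ + 1 ≠ 0 := Complex.slitPlane_ne_zero hs
  have hγ : (γ : ℂ) ≠ 0 := by norm_cast; linarith
  have hγ2 : 2 - (γ : ℂ) ≠ 0 := by
    norm_cast
    rw [sub_eq_zero]
    exact h₂.ne'
  have hd : ∀ c : ℂ, HasFDerivAt (fun ζ : ℂ => (ζ + 1) ^ c)
      (wirtingerCLM (c * (ζ + 1) ^ (c - 1)) 0) ζ := by
    intro c
    refine (((((hasDerivAt_id ζ).add_const 1).cpow_const hs).hasFDerivAt).restrictScalars ℝ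
      ).congr_fderiv ?_
    ext v
    simp [mul_comm]
  have h := (hd γ).add ((Complex.conjCLE : ℂ →L[ℝ] ℂ).hasFDerivAt.comp ζ
    ((hd (2 - γ)).const_mul (-(1 / ((γ : ℂ) * (2 - (γ : ℂ)))))))
  refine (h.congr_of_eventuallyEq (harmonicMap_eventuallyEq γ hζ)).congr_fderiv ?_
  have e : (ζ + 1) ^ (2 - (γ : ℂ) - 1) = ((ζ + 1) ^ ((γ : ℂ) - 1))⁻¹ := by
    rw [← Complex.cpow_neg]
    ring_nf
  ext v
  simp only [add_apply, wirtingerCLM_apply, weierstrassDatum, e,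
    ContinuousLinearMap.comp_apply, smul_apply, smul_eq_mul, map_mul,
    ContinuousLinearEquiv.coe_coe, Complex.conjCLE_apply, zero_mul, add_zero, map_inv₀]
  have h2 : (starRingEnd ℂ) 2 = 2 := Complex.conj_ofNat 2
  have h3 : (starRingEnd ℂ) ((ζ + 1) ^ ((γ : ℂ) - 1)) ≠ 0 := by
    simp [Complex.cpow_eq_zero_iff, hs0]
  simp [h2]
  field_simp

/-! ### Strong monotonicity and univalence -/

/-- By the mean value theorem on the segment from `y` to `x`, it suffices to bound `Re (dz(v) v̄)`
for `v = x - y`. The holomorphic part gives at least `γ |v|²` and the antiholomorphic part costs at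
most `|P|⁻¹ |v|² ≤ γ⁻¹ |v|²`. -/
theorem inner_sub_harmonicMap_sub {γ : ℝ} (h₁ : 1 < γ) (h₂ : γ < 2) {x y : ℂ}
    (hx : 0 ≤ x.re) (hy : 0 ≤ y.re) :
    (γ - γ⁻¹) * ‖x - y‖ ^ 2 ≤
      ((harmonicMap γ x - harmonicMap γ y) * (starRingEnd ℂ) (x - y)).re := by
  have hγ : 0 < γ := by linarith
  have hpath : ∀ t : ℝ, HasDerivAt (fun t : ℝ => y + t * (x - y)) (x - y) t := fun t => by
    simpa using ((Complex.ofRealCLM.hasDerivAt (x := t)).mul_const (x - y)).const_add y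
  have hre : ∀ t ∈ Set.Icc (0 : ℝ) 1, 0 ≤ (y + t * (x - y)).re := by
    rintro t ⟨ht0, ht1⟩
    rw [Complex.add_re, Complex.re_ofReal_mul, Complex.sub_re]
    nlinarith
  have hder : ∀ t ∈ Set.Icc (0 : ℝ) 1, HasDerivAt
      (fun t : ℝ => (harmonicMap γ (y + t * (x - y)) * (starRingEnd ℂ) (x - y)).re)
      (wirtingerCLM (weierstrassDatum γ (y + t * (x - y)))
        (-((starRingEnd ℂ) (weierstrassDatum γ (y + t * (x - y))))⁻¹) (x - y)
          * (starRingEnd ℂ) (x - y)).re t := by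
    intro t ht
    have h := ((hasFDerivAt_harmonicMap h₁ h₂
      (by linarith [hre t ht])).comp_hasDerivAt t (hpath t)).mul_const ((starRingEnd ℂ) (x - y))
    exact Complex.reCLM.hasFDerivAt.comp_hasDerivAt t h
  obtain ⟨t, ht, h⟩ := exists_hasDerivAt_eq_slope _ _ zero_lt_one
    (fun t ht => (hder t ht).continuousAt.continuousWithinAt)
    (fun t ht => hder t (Set.Ioo_subset_Icc_self ht))
  have ht' := hre t (Set.Ioo_subset_Icc_self ht)
  simp only [Complex.ofReal_one, one_mul, Complex.ofReal_zero, zero_mul, add_zero, sub_zero,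
    div_one, add_sub_cancel] at h
  rw [sub_mul (harmonicMap γ x), Complex.sub_re, ← h]
  have hp := le_weierstrassDatum_re h₁ h₂ ht'
  have hpn := le_norm_weierstrassDatum h₁ h₂ ht'
  generalize weierstrassDatum γ (y + t * (x - y)) = p at hp hpn ⊢
  rw [wirtingerCLM_apply, add_mul, Complex.add_re, mul_assoc, Complex.mul_conj,
    Complex.normSq_eq_norm_sq, Complex.re_mul_ofReal]
  have hb := (abs_le.1 (Complex.abs_re_le_norm
    (-((starRingEnd ℂ) p)⁻¹ * (starRingEnd ℂ) (x - y) * (starRingEnd ℂ) (x - y)))).1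
  simp only [norm_mul, norm_neg, norm_inv, RCLike.norm_conj] at hb
  have hinv : ‖p‖⁻¹ ≤ γ⁻¹ := inv_anti₀ hγ hpn
  have hsq := sq_nonneg ‖x - y‖
  nlinarith [mul_le_mul_of_nonneg_right hp hsq, mul_le_mul_of_nonneg_right hinv hsq]

theorem sub_inv_pos_of_one_lt {γ : ℝ} (h₁ : 1 < γ) : 0 < γ - γ⁻¹ := by
  have := inv_lt_one_of_one_lt₀ h₁
  linarith

theorem norm_sub_le_norm_harmonicMap_sub {γ : ℝ} (h₁ : 1 < γ) (h₂ : γ < 2) {x y : ℂ}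
    (hx : 0 ≤ x.re) (hy : 0 ≤ y.re) :
    (γ - γ⁻¹) * ‖x - y‖ ≤ ‖harmonicMap γ x - harmonicMap γ y‖ := by
  have h := (inner_sub_harmonicMap_sub h₁ h₂ hx hy).trans (Complex.re_le_norm _)
  rw [norm_mul, RCLike.norm_conj] at h
  rcases (norm_nonneg (x - y)).eq_or_lt with h0 | h0
  · rw [← h0, mul_zero]; positivity
  · nlinarith

/-- The closed right half-plane. -/
def closedHalfPlane : Set ℂ := {ζ | 0 ≤ ζ.re}

theorem isClosed_closedHalfPlane : IsClosed closedHalfPlane :=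
  isClosed_le continuous_const Complex.continuous_re

theorem isOpen_rightHalfPlane : IsOpen rightHalfPlane :=
  isOpen_lt continuous_const Complex.continuous_re

theorem rightHalfPlane_subset : rightHalfPlane ⊆ closedHalfPlane :=
  fun ζ (h : 0 < ζ.re) => show 0 ≤ ζ.re from h.le

theorem closure_rightHalfPlane : closure rightHalfPlane = closedHalfPlane :=
  Complex.closure_setOfPred_lt_re 0

theorem continuousAt_harmonicMap (γ : ℝ) {ζ : ℂ} (hζ : ζ ∈ closedHalfPlane) :
    ContinuousAt (harmonicMap γ) ζ :=
  (contDiffAt_harmonicMap γ (by linarith [show 0 ≤ ζ.re from hζ])).continuousAt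

theorem continuousOn_harmonicMap (γ : ℝ) : ContinuousOn (harmonicMap γ) closedHalfPlane :=
  fun _ hζ => (continuousAt_harmonicMap γ hζ).continuousWithinAt

theorem injOn_harmonicMap {γ : ℝ} (h₁ : 1 < γ) (h₂ : γ < 2) :
    Set.InjOn (harmonicMap γ) closedHalfPlane := by
  intro x hx y hy hxy
  have h := norm_sub_le_norm_harmonicMap_sub h₁ h₂ hx hy
  rw [hxy, sub_self, norm_zero] at h
  have := sub_inv_pos_of_one_lt h₁
  exact sub_eq_zero.1 (norm_le_zero_iff.1 (by nlinarith [norm_nonneg (x - y)]))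

theorem hasFDerivAt_harmonicMap_equiv {γ : ℝ} (h₁ : 1 < γ) (h₂ : γ < 2) {ζ : ℂ}
    (hζ : 0 ≤ ζ.re) :
    HasFDerivAt (harmonicMap γ) (weierstrassEquiv (weierstrassDatum γ ζ)
      (h₁.trans_le (le_norm_weierstrassDatum h₁ h₂ hζ)) : ℂ →L[ℝ] ℂ) ζ :=
  hasFDerivAt_harmonicMap h₁ h₂ (by linarith)

theorem map_nhds_harmonicMap {γ : ℝ} (h₁ : 1 < γ) (h₂ : γ < 2) {ζ : ℂ} (hζ : 0 ≤ ζ.re) :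
    map (harmonicMap γ) (𝓝 ζ) = 𝓝 (harmonicMap γ ζ) :=
  ((contDiffAt_harmonicMap γ (by linarith)).hasStrictFDerivAt'
    (hasFDerivAt_harmonicMap_equiv h₁ h₂ hζ) two_ne_zero).map_nhds_eq_of_equiv

/-! ### The image domain and its boundary -/

/-- The image `D` of the right half-plane. -/
def graphDomain (γ : ℝ) : Set ℂ := harmonicMap γ '' rightHalfPlane

theorem isOpen_graphDomain {γ : ℝ} (h₁ : 1 < γ) (h₂ : γ < 2) : IsOpen (graphDomain γ) := by
  rw [isOpen_iff_mem_nhds]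
  rintro _ ⟨ζ, hζ, rfl⟩
  rw [← map_nhds_harmonicMap h₁ h₂ (le_of_lt hζ)]
  exact image_mem_map (isOpen_rightHalfPlane.mem_nhds hζ)

theorem antilipschitz_harmonicMap {γ : ℝ} (h₁ : 1 < γ) (h₂ : γ < 2) :
    AntilipschitzWith (Real.toNNReal (γ - γ⁻¹)⁻¹)
      (fun x : closedHalfPlane => harmonicMap γ x) := by
  refine AntilipschitzWith.of_le_mul_dist fun x y => ?_
  have hpos := sub_inv_pos_of_one_lt h₁
  have h := norm_sub_le_norm_harmonicMap_sub h₁ h₂ x.2 y.2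
  rw [Real.coe_toNNReal _ (inv_pos.2 hpos).le, Subtype.dist_eq, dist_eq_norm, dist_eq_norm,
    inv_mul_eq_div, le_div_iff₀' hpos]
  exact h

/-- An antilipschitz map sends infinity to infinity; being continuous between proper spaces, it is
proper and therefore closed. -/
theorem isClosedEmbedding_harmonicMap {γ : ℝ} (h₁ : 1 < γ) (h₂ : γ < 2) :
    IsClosedEmbedding (fun x : closedHalfPlane => harmonicMap γ x) := by
  have : ProperSpace closedHalfPlane := .of_isClosed isClosed_closedHalfPlane
  have hc : Continuous (fun x : closedHalfPlane => harmonicMap γ x) :=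
    continuousOn_iff_continuous_domRestrict.1 (continuousOn_harmonicMap γ)
  refine .of_continuous_injective_isClosedMap hc (antilipschitz_harmonicMap h₁ h₂).injective ?_
  have ht := (antilipschitz_harmonicMap h₁ h₂).tendsto_cobounded
  rw [Metric.cobounded_eq_cocompact, Metric.cobounded_eq_cocompact] at ht
  exact (isProperMap_iff_tendsto_cocompact.2 ⟨hc, ht⟩).isClosedMap

theorem closure_graphDomain {γ : ℝ} (h₁ : 1 < γ) (h₂ : γ < 2) :
    closure (graphDomain γ) = harmonicMap γ '' closedHalfPlane := by
  apply subset_antisymm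
  · refine closure_minimal (Set.image_mono rightHalfPlane_subset) ?_
    have := (isClosedEmbedding_harmonicMap h₁ h₂).isClosed_range
    rwa [show (fun x : closedHalfPlane => harmonicMap γ x) = harmonicMap γ ∘ Subtype.val from rfl,
      Set.range_comp, Subtype.range_coe] at this
  · rw [← closure_rightHalfPlane]
    refine ContinuousOn.image_closure ?_
    rw [closure_rightHalfPlane]
    exact continuousOn_harmonicMap γ

theorem mem_frontier_graphDomain {γ : ℝ} (h₁ : 1 < γ) (h₂ : γ < 2) {w : ℂ} :
    w ∈ frontier (graphDomain γ) ↔ ∃ ζ : ℂ, ζ.re = 0 ∧ harmonicMap γ ζ = w := by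
  rw [(isOpen_graphDomain h₁ h₂).frontier_eq, closure_graphDomain h₁ h₂]
  constructor
  · rintro ⟨⟨ζ, hζ, rfl⟩, hn⟩
    refine ⟨ζ, le_antisymm (not_lt.1 fun h => hn ⟨ζ, h, rfl⟩) hζ, rfl⟩
  · rintro ⟨ζ, hζ, rfl⟩
    refine ⟨⟨ζ, hζ.ge, rfl⟩, ?_⟩
    rintro ⟨ζ', hζ', h⟩
    have := injOn_harmonicMap h₁ h₂ (rightHalfPlane_subset hζ') hζ.ge h
    have h3 : 0 < ζ'.re := hζ'
    rw [this, hζ] at h3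
    exact lt_irrefl _ h3

theorem isUnboundedDomain_graphDomain {γ : ℝ} (h₁ : 1 < γ) (h₂ : γ < 2) :
    IsUnboundedDomain (graphDomain γ) where
  isOpen := isOpen_graphDomain h₁ h₂
  isConnected := by
    refine IsConnected.image ⟨⟨1, by simp [rightHalfPlane]⟩, ?_⟩ _
      ((continuousOn_harmonicMap γ).mono rightHalfPlane_subset)
    exact (convex_halfSpace_re_gt 0).isPreconnected
  unbounded := by
    intro hb
    obtain ⟨C, hC⟩ := hb.exists_norm_le
    have hpos := sub_inv_pos_of_one_lt h₁
    -- The images of `n + 1` and `1` are then more than `2 C` apart.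
    obtain ⟨n, hn⟩ := exists_nat_gt (2 * C / (γ - γ⁻¹))
    have hC1 : ∀ t : ℝ, 0 < t → ‖harmonicMap γ t‖ ≤ C := fun t ht => hC _ ⟨t, by
      simpa [rightHalfPlane] using ht, rfl⟩
    have hn0 : (0 : ℝ) ≤ n := n.cast_nonneg
    have h := norm_sub_le_norm_harmonicMap_sub h₁ h₂ (x := ((n + 1 : ℝ) : ℂ)) (y := ((1 : ℝ) : ℂ))
      (by rw [Complex.ofReal_re]; positivity) (by simp)
    have e : ‖((n + 1 : ℝ) : ℂ) - ((1 : ℝ) : ℂ)‖ = n := by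
      push_cast
      simp
    rw [e] at h
    have h2 := norm_sub_le (harmonicMap γ ((n + 1 : ℝ) : ℂ)) (harmonicMap γ ((1 : ℝ) : ℂ))
    have h3 := hC1 (n + 1) (by positivity)
    have h4 := hC1 1 one_pos
    rw [div_lt_iff₀ hpos] at hn
    linarith

/-! ### The inverse map, the height function and the minimal surface equation -/

/-- The inverse of `harmonicMap γ` on the closed right half-plane. -/
def harmonicMapInv (γ : ℝ) : ℂ → ℂ := Function.invFunOn (harmonicMap γ) closedHalfPlane

theorem harmonicMapInv_harmonicMap {γ : ℝ} (h₁ : 1 < γ) (h₂ : γ < 2) {ζ : ℂ} (hζ : 0 ≤ ζ.re) :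
    harmonicMapInv γ (harmonicMap γ ζ) = ζ :=
  (injOn_harmonicMap h₁ h₂).leftInvOn_invFunOn hζ

theorem continuousOn_harmonicMapInv {γ : ℝ} (h₁ : 1 < γ) (h₂ : γ < 2) :
    ContinuousOn (harmonicMapInv γ) (closure (graphDomain γ)) := by
  rw [closure_graphDomain h₁ h₂]
  have hpos := sub_inv_pos_of_one_lt h₁
  refine (LipschitzOnWith.of_dist_le_mul (K := Real.toNNReal (γ - γ⁻¹)⁻¹) ?_).continuousOn
  rintro _ ⟨x, hx, rfl⟩ _ ⟨y, hy, rfl⟩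
  rw [harmonicMapInv_harmonicMap h₁ h₂ hx, harmonicMapInv_harmonicMap h₁ h₂ hy]
  exact (antilipschitz_harmonicMap h₁ h₂).le_mul_dist ⟨x, hx⟩ ⟨y, hy⟩

/-- `harmonicMap γ` as a homeomorphism of the half-plane onto its image. -/
def harmonicMapHomeomorph {γ : ℝ} (h₁ : 1 < γ) (h₂ : γ < 2) : OpenPartialHomeomorph ℂ ℂ where
  toFun := harmonicMap γ
  invFun := harmonicMapInv γ
  source := rightHalfPlane
  target := graphDomain γ
  map_source' := fun ζ hζ => ⟨ζ, hζ, rfl⟩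
  map_target' := by
    rintro _ ⟨ζ, hζ, rfl⟩
    rwa [harmonicMapInv_harmonicMap h₁ h₂ (rightHalfPlane_subset hζ)]
  left_inv' := fun ζ hζ => harmonicMapInv_harmonicMap h₁ h₂ (rightHalfPlane_subset hζ)
  right_inv' := by
    rintro _ ⟨ζ, hζ, rfl⟩
    rw [harmonicMapInv_harmonicMap h₁ h₂ (rightHalfPlane_subset hζ)]
  open_source := isOpen_rightHalfPlane
  open_target := isOpen_graphDomain h₁ h₂
  continuousOn_toFun := (continuousOn_harmonicMap γ).mono rightHalfPlane_subset
  continuousOn_invFun := (continuousOn_harmonicMapInv h₁ h₂).mono subset_closure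

theorem contDiffAt_harmonicMapInv {γ : ℝ} (h₁ : 1 < γ) (h₂ : γ < 2) {ζ : ℂ} (hζ : 0 < ζ.re) :
    ContDiffAt ℝ 2 (harmonicMapInv γ) (harmonicMap γ ζ) := by
  have e := harmonicMapInv_harmonicMap h₁ h₂ hζ.le
  refine (harmonicMapHomeomorph h₁ h₂).contDiffAt_symm
    (f₀' := weierstrassEquiv (weierstrassDatum γ ζ)
      (h₁.trans_le (le_norm_weierstrassDatum h₁ h₂ hζ.le))) ⟨ζ, hζ, rfl⟩ ?_ ?_
  · change HasFDerivAt (harmonicMap γ) _ (harmonicMapInv γ (harmonicMap γ ζ))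
    rw [e]
    exact hasFDerivAt_harmonicMap_equiv h₁ h₂ hζ.le
  · change ContDiffAt ℝ 2 (harmonicMap γ) (harmonicMapInv γ (harmonicMap γ ζ))
    rw [e]
    exact contDiffAt_harmonicMap γ (by linarith)

theorem hasFDerivAt_harmonicMapInv {γ : ℝ} (h₁ : 1 < γ) (h₂ : γ < 2) {ζ : ℂ} (hζ : 0 < ζ.re) :
    HasFDerivAt (harmonicMapInv γ) ((weierstrassEquiv (weierstrassDatum γ ζ)
      (h₁.trans_le (le_norm_weierstrassDatum h₁ h₂ hζ.le))).symm : ℂ →L[ℝ] ℂ)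
      (harmonicMap γ ζ) := by
  have e := harmonicMapInv_harmonicMap h₁ h₂ hζ.le
  refine HasFDerivAt.of_local_left_inverse (f := harmonicMap γ)
    (contDiffAt_harmonicMapInv h₁ h₂ hζ).continuousAt ?_ ?_
  · rw [e]
    exact hasFDerivAt_harmonicMap_equiv h₁ h₂ hζ.le
  · filter_upwards [(isOpen_graphDomain h₁ h₂).mem_nhds ⟨ζ, hζ, rfl⟩] with w hw
    exact (harmonicMapHomeomorph h₁ h₂).right_inv hw

/-- The height function `u`, with `u (z ζ) = 2 Re ζ`. -/
def graphHeight (γ : ℝ) (w : ℂ) : ℝ := 2 * (harmonicMapInv γ w).re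

theorem graphHeight_harmonicMap {γ : ℝ} (h₁ : 1 < γ) (h₂ : γ < 2) {ζ : ℂ} (hζ : 0 ≤ ζ.re) :
    graphHeight γ (harmonicMap γ ζ) = 2 * ζ.re := by
  rw [graphHeight, harmonicMapInv_harmonicMap h₁ h₂ hζ]

/-- With `t = |p|²`, the real part of the inverse differential at `v` is `Re (t p̄ v + p v̄) / (t² -
1)`. As `Re (p v̄) = Re (p̄ v)`, a factor `t + 1` cancels. -/
theorem hasGradientAt_graphHeight {γ : ℝ} (h₁ : 1 < γ) (h₂ : γ < 2) {ζ : ℂ} (hζ : 0 < ζ.re) :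
    HasGradientAt (graphHeight γ)
      (((2 / (‖weierstrassDatum γ ζ‖ ^ 2 - 1) : ℝ) : ℂ) * weierstrassDatum γ ζ)
      (harmonicMap γ ζ) := by
  rw [hasGradientAt_iff_hasFDerivAt]
  have h := (Complex.reCLM.hasFDerivAt.comp _ (hasFDerivAt_harmonicMapInv h₁ h₂ hζ)).const_mul 2
  refine h.congr_fderiv ?_
  have hp := h₁.trans_le (le_norm_weierstrassDatum h₁ h₂ hζ.le)
  rw [coe_weierstrassEquiv_symm]
  generalize weierstrassDatum γ ζ = p at hp
  ext v
  have hn : p * (starRingEnd ℂ) p = ((‖p‖ ^ 2 : ℝ) : ℂ) := by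
    rw [Complex.mul_conj, Complex.normSq_eq_norm_sq]
  have ht : 1 < ‖p‖ ^ 2 := by nlinarith
  generalize ‖p‖ ^ 2 = t at hn ht
  have e1 : (starRingEnd ℂ) p * t / ((t - 1) * (t + 1)) =
      ((t / ((t - 1) * (t + 1)) : ℝ) : ℂ) * (starRingEnd ℂ) p := by push_cast; ring
  have e2 : p / ((t - 1) * (t + 1)) =
      ((1 / ((t - 1) * (t + 1)) : ℝ) : ℂ) * p := by push_cast; ring
  have ht1 : t - 1 ≠ 0 := by linarith
  have ht2 : t + 1 ≠ 0 := by linarith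
  simp only [smul_apply, ContinuousLinearMap.comp_apply, wirtingerCLM_apply, hn, e1, e2,
    Complex.reCLM_apply, smul_eq_mul, InnerProductSpace.toDual_apply_apply, Complex.inner,
    Complex.add_re, map_mul, Complex.conj_ofReal, mul_assoc, Complex.ofReal_re, Complex.ofReal_im,
    zero_mul, sub_zero,
    Complex.mul_re, Complex.conj_re, Complex.conj_im, mul_left_comm v]
  field_simp

theorem sqrt_one_add_gradient_sq {t : ℝ} (ht : 1 < t) :
    Real.sqrt (1 + (2 / (t ^ 2 - 1) * t) ^ 2) = (t ^ 2 + 1) / (t ^ 2 - 1) := by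
  have h1 : 0 < t ^ 2 - 1 := by nlinarith
  rw [show 1 + (2 / (t ^ 2 - 1) * t) ^ 2 = ((t ^ 2 + 1) / (t ^ 2 - 1)) ^ 2 by field_simp; ring]
  exact Real.sqrt_sq (by positivity)

theorem flux_graphHeight {γ : ℝ} (h₁ : 1 < γ) (h₂ : γ < 2) {ζ : ℂ} (hζ : 0 < ζ.re) :
    (Real.sqrt (1 + ‖gradient (graphHeight γ) (harmonicMap γ ζ)‖ ^ 2))⁻¹ •
      gradient (graphHeight γ) (harmonicMap γ ζ) =
    2 * weierstrassDatum γ ζ /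
      (1 + weierstrassDatum γ ζ * (starRingEnd ℂ) (weierstrassDatum γ ζ)) := by
  have hp := h₁.trans_le (le_norm_weierstrassDatum h₁ h₂ hζ.le)
  rw [(hasGradientAt_graphHeight h₁ h₂ hζ).gradient]
  generalize weierstrassDatum γ ζ = p at hp
  have h1 : 0 < ‖p‖ ^ 2 - 1 := by nlinarith
  have h2 : (0 : ℝ) < ‖p‖ ^ 2 + 1 := by positivity
  rw [norm_mul, Complex.norm_real, Real.norm_of_nonneg (by positivity),
    sqrt_one_add_gradient_sq hp, Complex.mul_conj, Complex.normSq_eq_norm_sq, Complex.real_smul,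
    ← mul_assoc, ← Complex.ofReal_mul]
  rw [show ((‖p‖ ^ 2 + 1) / (‖p‖ ^ 2 - 1))⁻¹ * (2 / (‖p‖ ^ 2 - 1)) = 2 / (1 + ‖p‖ ^ 2) by
    rw [add_comm (1 : ℝ)]
    field_simp]
  push_cast
  ring

theorem isPositiveMinimalGraph_graphHeight {γ : ℝ} (h₁ : 1 < γ) (h₂ : γ < 2) :
    IsPositiveMinimalGraph (graphDomain γ) (graphHeight γ) where
  contDiffOn := by
    rintro _ ⟨ζ, hζ, rfl⟩
    exact (contDiffAt_const.mul (Complex.reCLM.contDiff.contDiffAt.comp _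
      (contDiffAt_harmonicMapInv h₁ h₂ hζ))).contDiffWithinAt
  continuousOn_closure :=
    (Complex.continuous_re.comp_continuousOn (continuousOn_harmonicMapInv h₁ h₂)).const_mul 2
  minimal := by
    rintro _ ⟨ζ, hζ, rfl⟩
    have hζ' : 0 < ζ.re := hζ
    have e := harmonicMapInv_harmonicMap h₁ h₂ hζ'.le
    have hev : (fun v => (Real.sqrt (1 + ‖gradient (graphHeight γ) v‖ ^ 2))⁻¹ •
        gradient (graphHeight γ) v) =ᶠ[𝓝 (harmonicMap γ ζ)] fun v =>
        2 * weierstrassDatum γ (harmonicMapInv γ v) /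
          (1 + weierstrassDatum γ (harmonicMapInv γ v) *
            (starRingEnd ℂ) (weierstrassDatum γ (harmonicMapInv γ v))) := by
      filter_upwards [(isOpen_graphDomain h₁ h₂).mem_nhds ⟨ζ, hζ, rfl⟩]
      rintro _ ⟨x, hx, rfl⟩
      rw [flux_graphHeight h₁ h₂ hx,
        harmonicMapInv_harmonicMap h₁ h₂ (rightHalfPlane_subset hx)]
    rw [minimalSurfaceOperator, planeDivergence, hev.fderiv_eq]
    have hφ := hasFDerivAt_harmonicMapInv h₁ h₂ hζ'
    refine planeDivergence_weierstrass_flux (w := harmonicMap γ ζ)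
      (P := weierstrassDatum γ) (φ := harmonicMapInv γ)
      (hasDerivAt_weierstrassDatum γ (by rw [e]; linarith))
      (h₁.trans_le (le_norm_weierstrassDatum h₁ h₂ (by rw [e]; exact hζ'.le))) ?_
    simpa only [e] using hφ
  pos := by
    rintro _ ⟨ζ, hζ, rfl⟩
    have hζ' : 0 < ζ.re := hζ
    rw [graphHeight_harmonicMap h₁ h₂ hζ'.le]
    positivity
  boundary := by
    intro w hw
    obtain ⟨ζ, hζ, rfl⟩ := (mem_frontier_graphDomain h₁ h₂).1 hw
    rw [graphHeight_harmonicMap h₁ h₂ hζ.ge, hζ, mul_zero]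

/-- A function that vanishes on `∂D`, is positive in `D` and continuous on `D̄` attains its maximum
on every circle which meets `D`. -/
theorem IsPositiveMinimalGraph.isGreatest_circleMax {D : Set ℂ} {u : ℂ → ℝ}
    (h : IsPositiveMinimalGraph D u) {r : ℝ} (hr : (D ∩ Metric.sphere 0 r).Nonempty) :
    IsGreatest (u '' (D ∩ Metric.sphere 0 r)) (circleMax D u r) := by
  have hcomp : IsCompact (closure D ∩ Metric.sphere 0 r) :=
    (isCompact_sphere 0 r).inter_left isClosed_closure
  obtain ⟨p, hp, hmax⟩ := hcomp.exists_isMaxOn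
    (hr.mono (Set.inter_subset_inter_left _ subset_closure))
    (h.continuousOn_closure.mono Set.inter_subset_left)
  obtain ⟨q, hq⟩ := hr
  have hpos : 0 < u p := (h.pos q hq.1).trans_le (hmax ⟨subset_closure hq.1, hq.2⟩)
  -- The maximum over the compact set in the closure is positive, so it is not taken on the
  -- frontier.
  have hpD : p ∈ D := by
    by_contra hn
    have : p ∈ frontier D := ⟨hp.1, fun hi => hn (interior_subset hi)⟩
    rw [h.boundary p this] at hpos
    exact lt_irrefl _ hpos
  have hg : IsGreatest (u '' (D ∩ Metric.sphere 0 r)) (u p) := by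
    refine ⟨⟨p, ⟨hpD, hp.2⟩, rfl⟩, ?_⟩
    rintro _ ⟨x, hx, rfl⟩
    exact hmax ⟨subset_closure hx.1, hx.2⟩
  rwa [circleMax, hg.csSup_eq]

/-! ### Asymptotics at infinity -/

theorem Complex.arg_cpow_ofReal {s : ℂ} (hs : s ≠ 0) {a : ℝ}
    (h : a * s.arg ∈ Set.Ioc (-Real.pi) Real.pi) : (s ^ (a : ℂ)).arg = a * s.arg := by
  rw [Complex.cpow_ofReal, mul_comm s.arg, Complex.ofReal_cos, Complex.ofReal_sin]
  exact Complex.arg_mul_cos_add_sin_mul_I (Real.rpow_pos_of_pos (norm_pos_iff.2 hs) a) h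

theorem one_le_norm_add_one {ζ : ℂ} (hζ : 0 ≤ ζ.re) : 1 ≤ ‖ζ + 1‖ := by
  have := Complex.re_le_norm (ζ + 1)
  rw [Complex.add_re, Complex.one_re] at this
  linarith

theorem add_one_ne_zero_of_re_nonneg {ζ : ℂ} (hζ : 0 ≤ ζ.re) : ζ + 1 ≠ 0 :=
  norm_pos_iff.1 (one_pos.trans_le (one_le_norm_add_one hζ))

theorem norm_conj_add_one_cpow {γ : ℝ} {ζ : ℂ} :
    ‖((starRingEnd ℂ) ζ + 1) ^ (2 - (γ : ℂ))‖ = ‖ζ + 1‖ ^ (2 - γ) := by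
  have h : (starRingEnd ℂ) ζ + 1 = (starRingEnd ℂ) (ζ + 1) := by simp
  rw [show 2 - (γ : ℂ) = ((2 - γ : ℝ) : ℂ) by push_cast; rfl, Complex.norm_cpow_real, h,
    RCLike.norm_conj]

theorem norm_harmonicMap_coeff {γ : ℝ} (h₁ : 1 < γ) (h₂ : γ < 2) :
    ‖1 / ((γ : ℂ) * (2 - (γ : ℂ)))‖ = 1 / (γ * (2 - γ)) := by
  rw [show 1 / ((γ : ℂ) * (2 - (γ : ℂ))) = ((1 / (γ * (2 - γ)) : ℝ) : ℂ) by push_cast; rfl,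
    Complex.norm_real, Real.norm_of_nonneg]
  have : 0 < 2 - γ := by linarith
  positivity

theorem norm_harmonicMap_le {γ : ℝ} (h₁ : 1 < γ) (h₂ : γ < 2) {ζ : ℂ} (hζ : 0 ≤ ζ.re) :
    ‖harmonicMap γ ζ‖ ≤ (1 + 1 / (γ * (2 - γ))) * ‖ζ + 1‖ ^ γ := by
  have h2 : 0 < 2 - γ := by linarith
  refine (norm_sub_le _ _).trans ?_
  rw [norm_mul, norm_harmonicMap_coeff h₁ h₂, norm_conj_add_one_cpow, Complex.norm_cpow_real,
    add_mul, one_mul]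
  have := Real.rpow_le_rpow_of_exponent_le (one_le_norm_add_one hζ) (by linarith : 2 - γ ≤ γ)
  gcongr

/-- Near infinity `harmonicMap γ ζ` is asymptotic to `(ζ + 1) ^ γ`. -/
theorem harmonicMap_asymptotic {γ : ℝ} (h₁ : 1 < γ) (h₂ : γ < 2) {η : ℝ} (hη : 0 < η) :
    ∀ᶠ r : ℝ in atTop, ∀ ζ : ℂ, 0 ≤ ζ.re → ‖harmonicMap γ ζ‖ = r →
      η⁻¹ ≤ ‖ζ + 1‖ ∧ ∃ E : ℂ, ‖E‖ < η ∧ harmonicMap γ ζ = (ζ + 1) ^ (γ : ℂ) * (1 - E) := by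
  have h2 : 0 < 2 - γ := by linarith
  have hlim : Tendsto (fun x : ℝ => 1 / (γ * (2 - γ)) * x ^ (-(2 * γ - 2))) atTop (𝓝 0) := by
    simpa using (tendsto_rpow_neg_atTop (by linarith : 0 < 2 * γ - 2)).const_mul (1 / (γ * (2 - γ)))
  obtain ⟨R, hR⟩ := eventually_atTop.1
    ((hlim.eventually_lt_const hη).and (eventually_ge_atTop η⁻¹))
  -- Since `|z|` is at most a constant times `|ζ + 1| ^ γ`, this threshold forces `|ζ + 1| ≥ R`.
  filter_upwards [eventually_gt_atTop ((1 + 1 / (γ * (2 - γ))) * |R| ^ γ)] with r hr ζ hζ hz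
  have hs1 := one_le_norm_add_one hζ
  have hs0 : 0 < ‖ζ + 1‖ := by linarith
  have hRs : R ≤ ‖ζ + 1‖ := by
    by_contra! hlt
    have hle := norm_harmonicMap_le h₁ h₂ hζ
    have : ‖ζ + 1‖ ^ γ ≤ |R| ^ γ :=
      Real.rpow_le_rpow hs0.le (hlt.le.trans (le_abs_self R)) (by linarith)
    have h3 : (1 + 1 / (γ * (2 - γ))) * ‖ζ + 1‖ ^ γ ≤ (1 + 1 / (γ * (2 - γ))) * |R| ^ γ := by
      gcongr
    linarith
  refine ⟨(hR _ hRs).2, 1 / ((γ : ℂ) * (2 - (γ : ℂ))) *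
    ((starRingEnd ℂ) ζ + 1) ^ (2 - (γ : ℂ)) / (ζ + 1) ^ (γ : ℂ), ?_, ?_⟩
  · rw [norm_div, norm_mul, norm_harmonicMap_coeff h₁ h₂, norm_conj_add_one_cpow,
      Complex.norm_cpow_real, mul_div_assoc, ← Real.rpow_sub hs0,
      show 2 - γ - γ = -(2 * γ - 2) by ring]
    exact (hR _ hRs).1
  · have : (ζ + 1) ^ (γ : ℂ) ≠ 0 := by
      simp [Complex.cpow_eq_zero_iff, add_one_ne_zero_of_re_nonneg hζ]
    rw [harmonicMap]
    field_simp

theorem abs_arg_add_one_lt {ζ : ℂ} (hζ : 0 ≤ ζ.re) : |(ζ + 1).arg| < Real.pi / 2 :=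
  Complex.abs_arg_lt_pi_div_two_iff.2 (Or.inl (by rw [Complex.add_re, Complex.one_re]; linarith))

theorem arg_harmonicMap_asymptotic {γ : ℝ} (h₁ : 1 < γ) (h₂ : γ < 2) {ε : ℝ} (hε : 0 < ε) :
    ∀ᶠ r : ℝ in atTop, ∀ ζ : ℂ, 0 ≤ ζ.re → ‖harmonicMap γ ζ‖ = r →
      |(harmonicMap γ ζ).arg - γ * (ζ + 1).arg| < ε := by
  have hπ := Real.pi_pos
  -- Because `γ π / 2 < π`, a perturbation of the argument smaller than this gap cannot cross the
  -- branch cut, so arguments add exactly.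
  have hgap : 0 < min ε (Real.pi - γ * (Real.pi / 2)) := lt_min hε (by nlinarith)
  have hcont : ContinuousAt Complex.arg 1 :=
    Complex.continuousAt_arg Complex.one_mem_slitPlane
  obtain ⟨η, hη, hηarg⟩ := Metric.continuousAt_iff.1 hcont _ hgap
  filter_upwards [harmonicMap_asymptotic h₁ h₂ (lt_min hη one_pos)] with r hr ζ hζ hz
  obtain ⟨-, E, hE, heq⟩ := hr ζ hζ hz
  have harg := hηarg (x := 1 - E) (by
    rw [dist_eq_norm, sub_sub_cancel_left, norm_neg]
    exact hE.trans_le (min_le_left _ _))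
  rw [Complex.arg_one, Real.dist_eq, sub_zero] at harg
  have hs := abs_arg_add_one_lt hζ
  have hγs : |γ * (ζ + 1).arg| < γ * (Real.pi / 2) := by
    rw [abs_mul, abs_of_pos (by linarith : 0 < γ)]
    gcongr
  have hb := harg.trans_le (min_le_right _ _)
  rw [abs_lt] at hγs hb
  have hs0 := add_one_ne_zero_of_re_nonneg hζ
  have hE0 : 1 - E ≠ 0 := by
    intro h0
    rw [← sub_eq_zero.1 h0, norm_one] at hE
    exact lt_irrefl _ (hE.trans_le (min_le_right _ _))
  have hpow : ((ζ + 1) ^ (γ : ℂ)).arg = γ * (ζ + 1).arg :=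
    Complex.arg_cpow_ofReal hs0 ⟨by nlinarith, by nlinarith⟩
  rw [heq, Complex.arg_mul (by simp [Complex.cpow_eq_zero_iff, hs0]) hE0
    (by rw [hpow]; constructor <;> linarith), hpow, add_sub_cancel_left]
  exact harg.trans_le (min_le_left _ _)

theorem harmonicMap_ofReal (γ : ℝ) {t : ℝ} (ht : 0 ≤ t) :
    harmonicMap γ t =
      (((t + 1) ^ γ - 1 / (γ * (2 - γ)) * (t + 1) ^ (2 - γ) : ℝ) : ℂ) := by
  have h : (0 : ℝ) ≤ t + 1 := by linarith
  rw [harmonicMap, Complex.conj_ofReal]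
  push_cast [Complex.ofReal_cpow h]
  rfl

/-- On the real axis `z` is real, with `z(0) ≤ 0`, so the intermediate value theorem reaches every
`r > 0`. This anchors the arc argument for the angle and bounds the growth from below. -/
theorem exists_harmonicMap_ofReal_eq {γ : ℝ} (h₁ : 1 < γ) (h₂ : γ < 2) {r : ℝ} (hr : 0 < r) :
    ∃ t : ℝ, 0 < t ∧ harmonicMap γ t = r ∧ r ≤ (t + 1) ^ γ := by
  have h2 : 0 < 2 - γ := by linarith
  have hpos := sub_inv_pos_of_one_lt h₁
  have hc : 1 ≤ 1 / (γ * (2 - γ)) := by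
    rw [le_div_iff₀ (by positivity)]
    nlinarith [sq_nonneg (γ - 1)]
  set f : ℝ → ℝ := fun t => (t + 1) ^ γ - 1 / (γ * (2 - γ)) * (t + 1) ^ (2 - γ) with hf
  have hf0 : f 0 = 1 - 1 / (γ * (2 - γ)) := by simp [hf]
  have hzf : ∀ t : ℝ, 0 ≤ t → harmonicMap γ t = f t := fun t ht => harmonicMap_ofReal γ ht
  -- Strong monotonicity gives `f T - f 0 ≥ (γ - γ⁻¹) T = r - f 0`.
  set T := (r - f 0) / (γ - γ⁻¹) with hT
  have hT0 : 0 < T := div_pos (by linarith) hpos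
  have hfT : r ≤ f T := by
    have h := inner_sub_harmonicMap_sub h₁ h₂ (x := (T : ℂ)) (y := ((0 : ℝ) : ℂ)) hT0.le (by simp)
    rw [hzf T hT0.le, hzf 0 le_rfl, Complex.ofReal_zero, sub_zero, Complex.conj_ofReal,
      Complex.norm_real, Real.norm_of_nonneg hT0.le, ← Complex.ofReal_sub, ← Complex.ofReal_mul,
      Complex.ofReal_re] at h
    have h3 : (γ - γ⁻¹) * T ≤ f T - f 0 := by
      refine le_of_mul_le_mul_right ?_ hT0
      linarith
    rw [hT, mul_div_cancel₀ _ hpos.ne', ← hT] at h3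
    linarith
  have hcont : ContinuousOn f (Set.Icc 0 T) := by
    intro t ht
    have h0 : t + 1 ≠ 0 := by linarith [ht.1]
    refine ContinuousAt.continuousWithinAt ?_
    have ha : ContinuousAt (fun t : ℝ => t + 1) t := by fun_prop
    exact (ha.rpow_const (Or.inl h0)).sub ((ha.rpow_const (Or.inl h0)).const_mul _)
  obtain ⟨t, ht, hft⟩ := intermediate_value_Icc hT0.le hcont ⟨by linarith, hfT⟩
  refine ⟨t, ht.1.lt_of_ne ?_, by rw [hzf t ht.1, hft], ?_⟩
  · rintro rfl
    linarith
  · rw [← hft]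
    have : 0 ≤ t + 1 := by linarith [ht.1]
    have : 0 ≤ 1 / (γ * (2 - γ)) * (t + 1) ^ (2 - γ) := by positivity
    simp only [hf]
    linarith

/-! ### The asymptotic angle -/

theorem arg_circleMap_zero {r θ : ℝ} (hr : 0 < r) (hθ : θ ∈ Set.Ioc (-Real.pi) Real.pi) :
    (circleMap 0 r θ).arg = θ := by
  rw [circleMap_zero, Complex.exp_mul_I]
  exact Complex.arg_mul_cos_add_sin_mul_I hr hθ

theorem norm_circleMap_zero' {r θ : ℝ} (hr : 0 < r) : ‖circleMap 0 r θ‖ = r := by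
  rw [norm_circleMap_zero, abs_of_pos hr]

/-- For large `r`, the points of `D` on `|z| = r` have argument at most `γ π / 2 + ε`. -/
theorem abs_le_of_circleMap_mem {γ : ℝ} (h₁ : 1 < γ) (h₂ : γ < 2) {ε : ℝ} (hε : 0 < ε) :
    ∀ᶠ r : ℝ in atTop, ∀ θ ∈ Set.Ioc (-Real.pi) Real.pi, circleMap 0 r θ ∈ graphDomain γ →
      |θ| < γ * (Real.pi / 2) + ε := by
  filter_upwards [arg_harmonicMap_asymptotic h₁ h₂ hε, eventually_gt_atTop 0]
    with r hr hr0 θ hθ ⟨ζ, hζ, hz⟩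
  have hζ' : 0 ≤ ζ.re := rightHalfPlane_subset hζ
  have h := hr ζ hζ' (by rw [hz, norm_circleMap_zero' hr0])
  rw [hz, arg_circleMap_zero hr0 hθ] at h
  have hs : |γ * (ζ + 1).arg| < γ * (Real.pi / 2) := by
    rw [abs_mul, abs_of_pos (by linarith : 0 < γ)]
    gcongr
    exact abs_arg_add_one_lt hζ'
  have := abs_sub_abs_le_abs_sub θ (γ * (ζ + 1).arg)
  linarith

/-- For large `r`, the points of `∂D` on `|z| = r` have argument at least `γ π / 2 - ε`. -/
theorem lt_abs_arg_of_mem_frontier {γ : ℝ} (h₁ : 1 < γ) (h₂ : γ < 2) {ε : ℝ} (hε : 0 < ε) :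
    ∀ᶠ r : ℝ in atTop, ∀ w ∈ frontier (graphDomain γ), ‖w‖ = r →
      γ * (Real.pi / 2) - ε < |w.arg| := by
  have hγ : 0 < γ := by linarith
  have hπ := Real.pi_pos
  set α := max 0 (Real.pi / 2 - ε / 2 / γ) with hα
  have hα2 : α < Real.pi / 2 := max_lt (by linarith) (by linarith [div_pos (half_pos hε) hγ])
  have hα0 : 0 ≤ α := le_max_left _ _
  have hcos : 0 < Real.cos α := Real.cos_pos_of_mem_Ioo ⟨by linarith, hα2⟩
  filter_upwards [arg_harmonicMap_asymptotic h₁ h₂ (half_pos hε),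
    harmonicMap_asymptotic h₁ h₂ (half_pos hcos)] with r hr hr' w hw hwr
  obtain ⟨ζ, hζ, rfl⟩ := (mem_frontier_graphDomain h₁ h₂).1 hw
  have h := hr ζ hζ.ge hwr
  have hs := (hr' ζ hζ.ge hwr).1
  have hs0 := one_pos.trans_le (one_le_norm_add_one hζ.ge)
  -- On the imaginary axis `cos (arg (ζ + 1)) = 1 / |ζ + 1|`, which is at most `cos α / 2` here.
  have hlt : α < |(ζ + 1).arg| := by
    by_contra! hle
    have hc := Real.cos_le_cos_of_nonneg_of_le_pi (abs_nonneg _) (by linarith) hle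
    rw [Real.cos_abs, Complex.cos_arg (norm_pos_iff.1 hs0), le_div_iff₀ hs0, Complex.add_re, hζ,
      Complex.one_re] at hc
    rw [inv_le_iff_one_le_mul₀ (half_pos hcos)] at hs
    linarith
  have hlt2 : Real.pi / 2 - ε / 2 / γ < |(ζ + 1).arg| := (le_max_right _ _).trans_lt hlt
  have h4 : γ * (Real.pi / 2) - ε / 2 < |γ * (ζ + 1).arg| := by
    rw [abs_mul, abs_of_pos hγ]
    have := mul_lt_mul_of_pos_left hlt2 hγ
    rwa [mul_sub, mul_div_cancel₀ _ hγ.ne'] at this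
  have := abs_sub_abs_le_abs_sub (γ * (ζ + 1).arg) (harmonicMap γ ζ).arg
  rw [abs_sub_comm] at h
  linarith

/-- For large `r`, `D` contains the points of `|z| = r` with argument at most `γ π / 2 - ε`. -/
theorem circleMap_mem_of_abs_le {γ : ℝ} (h₁ : 1 < γ) (h₂ : γ < 2) {ε : ℝ} (hε : 0 < ε)
    (hε' : ε ≤ γ * (Real.pi / 2)) :
    ∀ᶠ r : ℝ in atTop, ∀ θ : ℝ, |θ| ≤ γ * (Real.pi / 2) - ε →
      circleMap 0 r θ ∈ graphDomain γ := by
  have hπ := Real.pi_pos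
  filter_upwards [lt_abs_arg_of_mem_frontier h₁ h₂ hε, eventually_gt_atTop 0] with r hr hr0
  set A : Set ℂ := circleMap 0 r '' Set.Icc (-(γ * (Real.pi / 2) - ε)) (γ * (Real.pi / 2) - ε)
    with hA
  have hAc : IsPreconnected A := isPreconnected_Icc.image _ (continuous_circleMap 0 r).continuousOn
  have hsub : A ⊆ graphDomain γ := by
    -- The arc is connected, misses the frontier by the previous bound, and contains the point `r`
    -- of `D`.
    refine hAc.subset_left_of_subset_union (isOpen_graphDomain h₁ h₂)
      (v := (closure (graphDomain γ))ᶜ) isClosed_closure.isOpen_compl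
      (disjoint_compl_right.mono_left subset_closure) ?_ ?_
    · rintro _ ⟨θ, hθ, rfl⟩
      by_contra hn
      rw [Set.mem_union, not_or, Set.notMem_compl_iff] at hn
      have hf : circleMap 0 r θ ∈ frontier (graphDomain γ) :=
        ⟨hn.2, fun h => hn.1 (interior_subset h)⟩
      have h := hr _ hf (norm_circleMap_zero' hr0)
      rw [arg_circleMap_zero hr0 ⟨by nlinarith [hθ.1], by nlinarith [hθ.2]⟩] at h
      exact absurd (abs_le.2 hθ) (not_le.2 h)
    · obtain ⟨t, ht, hz, -⟩ := exists_harmonicMap_ofReal_eq h₁ h₂ hr0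
      refine ⟨r, ⟨0, ⟨by linarith, by linarith⟩, by simp [circleMap]⟩, t, ?_, hz⟩
      simpa [rightHalfPlane] using ht
  exact fun θ hθ => hsub ⟨θ, abs_le.1 hθ, rfl⟩

theorem tendsto_angularMeasure_graphDomain {γ : ℝ} (h₁ : 1 < γ) (h₂ : γ < 2) :
    Tendsto (angularMeasure (graphDomain γ)) atTop (𝓝 (ENNReal.ofReal (γ * Real.pi))) := by
  have hπ := Real.pi_pos
  rw [ENNReal.tendsto_nhds ENNReal.ofReal_ne_top]
  intro δ hδ
  obtain ⟨ε, hε, hεδ⟩ : ∃ ε : ℝ, 0 < ε ∧ ENNReal.ofReal (2 * ε) ≤ δ := by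
    rcases eq_or_ne δ ⊤ with rfl | hδt
    · exact ⟨1, one_pos, le_top⟩
    · refine ⟨δ.toReal / 2, half_pos (ENNReal.toReal_pos hδ.ne' hδt), ?_⟩
      rw [mul_div_cancel₀ _ two_ne_zero, ENNReal.ofReal_toReal hδt]
  have hγπ : 0 < γ * (Real.pi / 2) := by positivity
  filter_upwards [abs_le_of_circleMap_mem h₁ h₂ hε,
    circleMap_mem_of_abs_le h₁ h₂ (lt_min hε hγπ) (min_le_right _ _)] with r hup hlo
  constructor
  · rw [tsub_le_iff_right]
    calc ENNReal.ofReal (γ * Real.pi)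
        = ENNReal.ofReal (2 * (γ * (Real.pi / 2) - min ε (γ * (Real.pi / 2))) +
            2 * min ε (γ * (Real.pi / 2))) := by congr 1; ring
      _ ≤ ENNReal.ofReal (2 * (γ * (Real.pi / 2) - min ε (γ * (Real.pi / 2)))) +
            ENNReal.ofReal (2 * min ε (γ * (Real.pi / 2))) := ENNReal.ofReal_add_le
      _ ≤ angularMeasure (graphDomain γ) r + δ := by
        gcongr
        · rw [angularMeasure]
          set α := γ * (Real.pi / 2) - min ε (γ * (Real.pi / 2)) with hα
          have hαπ : α < Real.pi := by
            have := lt_min hε hγπ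
            nlinarith
          calc ENNReal.ofReal (2 * α) = volume (Set.Icc (-α) α) := by
                rw [Real.volume_Icc]; congr 1; ring
            _ ≤ volume {θ : ℝ | θ ∈ Set.Ioc (-Real.pi) Real.pi ∧
                circleMap 0 r θ ∈ graphDomain γ} := measure_mono fun θ hθ =>
                ⟨⟨by linarith [hθ.1], by linarith [hθ.2]⟩, hlo θ (abs_le.2 hθ)⟩
        · exact (ENNReal.ofReal_le_ofReal (by linarith [min_le_left ε (γ * (Real.pi / 2))])).trans
            hεδ
  · calc angularMeasure (graphDomain γ) r
        ≤ volume (Set.Icc (-(γ * (Real.pi / 2) + ε)) (γ * (Real.pi / 2) + ε)) :=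
          measure_mono fun θ hθ => abs_le.1 (hup θ hθ.1 hθ.2).le
      _ = ENNReal.ofReal (γ * Real.pi + 2 * ε) := by
          rw [Real.volume_Icc]; congr 1; ring
      _ ≤ ENNReal.ofReal (γ * Real.pi) + ENNReal.ofReal (2 * ε) := ENNReal.ofReal_add_le
      _ ≤ ENNReal.ofReal (γ * Real.pi) + δ := by gcongr

theorem asymptoticAngle_graphDomain {γ : ℝ} (h₁ : 1 < γ) (h₂ : γ < 2) :
    asymptoticAngle (graphDomain γ) = ENNReal.ofReal (γ * Real.pi) := by
  have hπ := Real.pi_pos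
  refine Tendsto.limsup_eq ((tendsto_angularMeasure_graphDomain h₁ h₂).congr' ?_)
  -- With this `ε` the upper bound on `|θ|` is exactly `π`, so `-r` is outside `D` and `Θ*` equals
  -- `Θ`.
  have hgap : 0 < Real.pi - γ * (Real.pi / 2) := by nlinarith
  filter_upwards [abs_le_of_circleMap_mem h₁ h₂ hgap, eventually_ge_atTop 0] with r hr hr0
  rw [angularMeasureStar, if_neg]
  intro hsub
  have h := hr Real.pi ⟨by linarith, le_rfl⟩ (hsub (circleMap_mem_sphere 0 hr0 _))
  rw [abs_of_pos hπ] at h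
  linarith

/-! ### The order of growth -/

theorem growthOrder_graphHeight {γ : ℝ} (h₁ : 1 < γ) (h₂ : γ < 2) :
    growthOrder (graphDomain γ) (graphHeight γ) = ((γ⁻¹ : ℝ) : EReal) := by
  have hγ : 0 < γ := by linarith
  have hlog := Real.tendsto_log_atTop
  have hup : Tendsto (fun r : ℝ => γ⁻¹ + (Real.log 2 + γ⁻¹ * Real.log 2) / Real.log r) atTop
      (𝓝 γ⁻¹) := by
    simpa using (hlog.const_div_atTop (Real.log 2 + γ⁻¹ * Real.log 2)).const_add γ⁻¹
  refine Tendsto.limsup_eq ((continuous_coe_real_ereal.tendsto _).comp ?_)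
  -- This absorbs the shift by `1`: `2 t ≥ 2 (r ^ γ⁻¹ - 1) ≥ r ^ γ⁻¹`.
  have hlarge := (tendsto_rpow_atTop (inv_pos.2 hγ)).eventually_ge_atTop 2
  have hboth : ∀ᶠ r : ℝ in atTop,
      γ⁻¹ ≤ Real.log (circleMax (graphDomain γ) (graphHeight γ) r) / Real.log r ∧
      Real.log (circleMax (graphDomain γ) (graphHeight γ) r) / Real.log r ≤
        γ⁻¹ + (Real.log 2 + γ⁻¹ * Real.log 2) / Real.log r := by
    filter_upwards [harmonicMap_asymptotic h₁ h₂ (half_pos one_pos), eventually_gt_atTop 1,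
      hlarge] with r hr hr1 hr2
    have hr0 : 0 < r := by linarith
    have hlr : 0 < Real.log r := Real.log_pos hr1
    obtain ⟨t, ht, hz, hrt⟩ := exists_harmonicMap_ofReal_eq h₁ h₂ hr0
    have hmem : (r : ℂ) ∈ graphDomain γ ∩ Metric.sphere 0 r := by
      refine ⟨⟨t, by simpa [rightHalfPlane] using ht, hz⟩, ?_⟩
      rw [mem_sphere_zero_iff_norm, Complex.norm_real, Real.norm_of_nonneg hr0.le]
    obtain ⟨⟨w, ⟨⟨ζ, hζ, rfl⟩, hw⟩, hwM⟩, hmax⟩ :=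
      (isPositiveMinimalGraph_graphHeight h₁ h₂).isGreatest_circleMax ⟨_, hmem⟩
    have hlow : r ^ γ⁻¹ ≤ circleMax (graphDomain γ) (graphHeight γ) r := by
      have h := hmax ⟨_, hmem, rfl⟩
      rw [← hz, graphHeight_harmonicMap h₁ h₂ (by simpa using ht.le), Complex.ofReal_re] at h
      have h3 : r ^ γ⁻¹ ≤ t + 1 := by
        rw [← Real.rpow_rpow_inv (by linarith : 0 ≤ t + 1) hγ.ne']
        gcongr
      linarith
    have hpow : 0 < r ^ γ⁻¹ := by positivity
    have hM0 := hpow.trans_le hlow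
    have hupp : circleMax (graphDomain γ) (graphHeight γ) r ≤ 2 * (2 * r) ^ γ⁻¹ := by
      have hζ' : 0 ≤ ζ.re := rightHalfPlane_subset hζ
      rw [mem_sphere_zero_iff_norm] at hw
      obtain ⟨-, E, hE, heq⟩ := hr ζ hζ' hw
      rw [heq, norm_mul, Complex.norm_cpow_real] at hw
      -- Taking `|E| < 1/2` turns the asymptotics into `|ζ + 1| ^ γ ≤ 2 r`, the source of the
      -- constants `log 2` in the upper bound.
      have hE1 : 1 / 2 ≤ ‖1 - E‖ := by
        have := norm_sub_norm_le (1 : ℂ) E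
        rw [norm_one] at this
        linarith
      have hs : ‖ζ + 1‖ ^ γ ≤ 2 * r := by
        nlinarith [Real.rpow_nonneg (norm_nonneg (ζ + 1)) γ]
      have hs' : ‖ζ + 1‖ ≤ (2 * r) ^ γ⁻¹ := by
        rw [← Real.rpow_rpow_inv (norm_nonneg (ζ + 1)) hγ.ne']
        gcongr
      have hre := Complex.re_le_norm (ζ + 1)
      rw [Complex.add_re, Complex.one_re] at hre
      rw [← hwM, graphHeight_harmonicMap h₁ h₂ hζ']
      linarith
    constructor
    · rw [le_div_iff₀ hlr, ← Real.log_rpow hr0]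
      exact Real.log_le_log hpow hlow
    · rw [div_le_iff₀ hlr, add_mul, div_mul_cancel₀ _ hlr.ne']
      refine (Real.log_le_log hM0 hupp).trans_eq ?_
      rw [Real.log_mul two_ne_zero (by positivity), Real.log_rpow (by positivity),
        Real.log_mul two_ne_zero hr0.ne']
      ring
  exact tendsto_of_tendsto_of_tendsto_of_le_of_le' tendsto_const_nhds hup
    (hboth.mono fun _ h => h.1) (hboth.mono fun _ h => h.2)

end

theorem mainTheorem3 (β : ℝ) (hβ₁ : Real.pi < β) (hβ₂ : β < 2 * Real.pi) :
    InnerProductSpace.HarmonicOnNhd (harmonicMap (β / Real.pi)) rightHalfPlane ∧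
    Set.InjOn (harmonicMap (β / Real.pi)) rightHalfPlane ∧
    ∃ (D : Set ℂ) (u : ℂ → ℝ),
      D = harmonicMap (β / Real.pi) '' rightHalfPlane ∧
      (∀ ζ ∈ rightHalfPlane, u (harmonicMap (β / Real.pi) ζ) = 2 * ζ.re) ∧
      IsUnboundedDomain D ∧
      asymptoticAngle D = ENNReal.ofReal β ∧
      IsPositiveMinimalGraph D u ∧
      (∀ r : ℝ, (D ∩ Metric.sphere 0 r).Nonempty →
        IsGreatest (u '' (D ∩ Metric.sphere 0 r)) (circleMax D u r)) ∧
      growthOrder D u = ((Real.pi / β : ℝ) : EReal) := by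
  have hπ := Real.pi_pos
  have h₁ : 1 < β / Real.pi := (one_lt_div hπ).2 hβ₁
  have h₂ : β / Real.pi < 2 := (div_lt_iff₀ hπ).2 hβ₂
  have hgraph := isPositiveMinimalGraph_graphHeight h₁ h₂
  refine ⟨fun ζ hζ => harmonicAt_harmonicMap _ (by linarith [show 0 < ζ.re from hζ]),
    (injOn_harmonicMap h₁ h₂).mono rightHalfPlane_subset,
    graphDomain (β / Real.pi), graphHeight (β / Real.pi), rfl,
    fun ζ hζ => graphHeight_harmonicMap h₁ h₂ (rightHalfPlane_subset hζ),
    isUnboundedDomain_graphDomain h₁ h₂, ?_, hgraph,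
    fun r hr => hgraph.isGreatest_circleMax hr, ?_⟩
  · rw [asymptoticAngle_graphDomain h₁ h₂, div_mul_cancel₀ _ hπ.ne']
  · rw [growthOrder_graphHeight h₁ h₂, inv_div]
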